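/- **Setting.** Let $\mathrm G=(\mathrm V,\mathrm E)$ be a finite, undirected, connected graph with weights $w_{ij}=w_{ji}>0$ for $(i,j)\in\mathrm E$, $w_{ij}=0$ for $(i,j)\notin\mathrm E$, and $\sum_{j\in\mathrm V} w_{ij}<1$ for all $i\in\mathrm V$. Consider the average consensus algorithm $$x_i(t+1)=x_i(t)+u_i(t),\qquad u_i(t)=\sum_{j\in \mathrm V}w_{ij}\bigl(y_j(t)-y_i(t)\bigr),\qquad y_i(t)=x_i(t)+\gamma_i(t),$$ with states $x_i(t)$, publicly observed messages $y_i(t)$ and noise $\gamma_i(t)=\sigma_i\eta_i$ for all $t\ge 0$, where $(\eta_i)_{i\in \mathrm V}$ are independent real random variables. For $T\ge 1$ running steps write $\mathbf x=(x_i(t))_{i\in \mathrm V,\,0\le t\le T-1}$ for the stacked node state trajectories. Given the public inputs $\mathbf b=(u_i(t))_{i\in\mathrm V,\,0\le t\le T-2}$ they lie on the affine manifold $\mathcal C_d=\{\mathbf x:\mathbf D\mathbf x+\mathbf b=0\}$, where $\mathbf D$ is block diagonal with one $(T-1)\times T$ block per node, whose rows are $(0,\dots,0,1,-1,0,\dots,0)$;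 that is, $x_i(t)-x_i(t+1)+u_i(t)=0$. **Adjacency.** Let $\mathbf D$ have $q$ rows. Points $\mathbf x,\mathbf x'\in\mathcal C_d$ are manifold $\mu$-adjacent if there are a set $\mathrm d$ of $q$ coordinates for which the square submatrix $\mathbf D_{\mathrm d}$ of the columns in $\mathrm d$ is nonsingular, and a coordinate $k\notin \mathrm d$, such that $|x_k-x'_k|\le\mu$, $x_l=x'_l$ for all $l\notin \mathrm d\cup\{k\}$, and $\mathbf x_{\mathrm d}-\mathbf x'_{\mathrm d}=-\mathbf D_{\mathrm d}^{-1}\mathbf D_{-\mathrm d}(\mathbf x_{-\mathrm d}-\mathbf x'_{-\mathrm d})$, where $-\mathrm d$ is the complement of $\mathrm d$. **Calibration.** Let $\Phi$ be the standard normal distribution function, $\kappa(x,y)=\Phi\bigl(\tfrac y2-\tfrac xy\bigr)-e^{x}\Phi\bigl(-\tfrac y2-\tfrac xy\bigr)$, let $\kappa_x^{-1}$ be the inverse of $y\mapsto\kappa(x,y)$ on $(0,\infty)$, and $\kappa_x^{-2}(\delta)=(\kappa_x^{-1}(\delta))^2$. Let $\mathcal L(0,1)$ be the Laplace distribution with density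 $\tfrac12e^{-|v|}$. **Theorem.** Let $\epsilon,\mu>0$ and let either of the following hold: (i) (Gaussian) $0<\delta<1$, $\eta_i\sim\mathcal N(0,1)$ and $\sigma_i^2\ge\mu^2/\kappa_\epsilon^{-2}(\delta)$ for all $i\in \mathrm V$; (ii) (Laplace) $\delta=0$, $\eta_i\sim\mathcal L(0,1)$ and $\sigma_i\ge\mu/\epsilon$ for all $i\in \mathrm V$. Then the algorithm preserves $(\epsilon,\delta)$-differential privacy of all node state trajectories under manifold $\mu$-adjacency. That is, for every $T\ge1$: (a) for every $\mathbf b$, the mechanism $\mathscr M(\mathbf x)=(x_i(t)+\gamma_i(t))_{i\in \mathrm V,\,0\le t\le T-1}$ satisfies $\mathbb P(\mathscr M(\mathbf x)\in R)\le e^{\epsilon}\,\mathbb P(\mathscr M(\mathbf x')\in R)+\delta$ for all manifold $\mu$-adjacent $\mathbf x,\mathbf x'\in\mathcal C_d$ and all measurable $R$; (b) the same inequality holds when $\mathscr M(\mathbf x)$ is the vector of all messages $y_i(t)$, $i\in\mathrm V$, $0\le t\le T-1$, produced by actually running the algorithm from the initial states $x_i(0)$ of $\mathbf x$, for all manifold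 $\mu$-adjacent $\mathbf x,\mathbf x'\in\mathcal C_d$ whose inputs $\mathbf b$ are those computed from a common message record $(y_i(t))_{i\in\mathrm V,\,0\le t\le T-1}$. -/

import Mathlib

open MeasureTheory ProbabilityTheory

namespace AffineDP

noncomputable section

/-! ### Noise distributions and calibration function -/

/-- The Laplace distribution with mean `m` and scale `s` (variance `2 * s ^ 2`, for `0 < s`). -/
def laplaceMeasure (m s : ℝ) : Measure ℝ :=
  (volume : Measure ℝ).withDensity
    (fun v => ENNReal.ofReal ((2 * s)⁻¹ * Real.exp (-|v - m| / s)))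

/-- The standard normal cumulative distribution function. -/
def Phi (v : ℝ) : ℝ := cdf (gaussianReal 0 1) v

/-- `κ(x, y) = Φ(y/2 - x/y) - e^x Φ(-y/2 - x/y)`. -/
def kappa (x y : ℝ) : ℝ :=
  Phi (y / 2 - x / y) - Real.exp x * Phi (-(y / 2) - x / y)

/-- `κ_x⁻¹`, the inverse of the map `y ↦ κ(x, y)` on `(0, ∞)`. -/
def kappaInv (x d : ℝ) : ℝ := Function.invFunOn (kappa x) (Set.Ioi 0) d

/-! ### Differential privacy over affine manifolds -/

section Manifold

variable {ι q Ω β : Type*} [Fintype ι] [DecidableEq ι] [Fintype q] [DecidableEq q]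

/-- The affine manifold `{x : D x + b = 0}`. -/
def affineManifold (D : Matrix q ι ℝ) (b : q → ℝ) : Set (ι → ℝ) :=
  {x | D.mulVec x + b = 0}

/-- Manifold `μ`-adjacency. The embedding `d` enumerates the set `d_j` of `q` columns for which
the square matrix `D_{d_j}` is nonsingular; the subtype `{k // k ∉ Set.range d}` is the
complementary set `-d_j`. -/
def ManifoldAdj (D : Matrix q ι ℝ) (μ : ℝ) (x x' : ι → ℝ) : Prop :=
  ∃ d : q ↪ ι, IsUnit (D.submatrix id d).det ∧
    ∃ i, i ∉ Set.range d ∧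
      |x i - x' i| ≤ μ ∧
      (∀ k, k ∉ Set.range d → k ≠ i → x k = x' k) ∧
      (fun a : q => x (d a) - x' (d a)) =
        -((D.submatrix id d)⁻¹ * D.submatrix id
            (Subtype.val : {k // k ∉ Set.range d} → ι)).mulVec
          (fun k => x k - x' k)

/-- `(ε, δ)`-differential privacy, over the affine manifold `{x : D x + b = 0}` and under
manifold `μ`-adjacency, of the randomized mechanism `M`. -/
def DiffPrivateOver [MeasurableSpace Ω] [MeasurableSpace β] (P : Measure Ω)
    (M : (ι → ℝ) → Ω → β) (D : Matrix q ι ℝ) (b : q → ℝ) (μ ε δ : ℝ) : Prop :=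
  ∀ x ∈ affineManifold D b, ∀ x' ∈ affineManifold D b, ManifoldAdj D μ x x' →
    ∀ R : Set β, MeasurableSet R →
      P.real {ω | M x ω ∈ R} ≤ Real.exp ε * P.real {ω | M x' ω ∈ R} + δ

end Manifold

/-- The mechanism `x ↦ F x + γ`. -/
def linearMechanism {ι κ Ω : Type*} [Fintype ι] (F : Matrix κ ι ℝ) (γ : Ω → κ → ℝ)
    (x : ι → ℝ) (ω : Ω) : κ → ℝ :=
  F.mulVec x + γ ω

/-! ### The average consensus algorithm -/

section Consensus

variable {V : Type*}

/-- Admissible edge weights on the undirected communication graph `G`. -/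
structure IsConsensusWeight [Fintype V] (G : SimpleGraph V) (w : V → V → ℝ) : Prop where
  symm : ∀ i j, w i j = w j i
  pos : ∀ i j, G.Adj i j → 0 < w i j
  zero : ∀ i j, ¬ G.Adj i j → w i j = 0
  sum_lt_one : ∀ i, ∑ j, w i j < 1

/-- The control input `u_i = ∑_j w_ij (y_j - y_i)` computed from the messages `y` of one step. -/
def ctrlInput [Fintype V] (w : V → V → ℝ) (y : V → ℝ) (i : V) : ℝ :=
  ∑ j, w i j * (y j - y i)

/-- The node states `x_i(t)` of the algorithm with initial states `x0` and noises `γ i t`. -/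
def state [Fintype V] (w : V → V → ℝ) (γ : V → ℕ → ℝ) (x0 : V → ℝ) : ℕ → V → ℝ
  | 0 => x0
  | t + 1 => fun i =>
      state w γ x0 t i + ctrlInput w (fun j => state w γ x0 t j + γ j t) i

/-- The communication messages `y_i(t) = x_i(t) + γ_i(t)` of the algorithm. -/
def message [Fintype V] (w : V → V → ℝ) (γ : V → ℕ → ℝ) (x0 : V → ℝ) (t : ℕ) (i : V) : ℝ :=
  state w γ x0 t i + γ i t

/-- The noise which is constant in time at each node: `γ_i(t) = σ_i η_i`. -/
def constNoise {Ω : Type*} (σ : V → ℝ) (η : V → Ω → ℝ) (ω : Ω) (i : V) (_t : ℕ) : ℝ :=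
  σ i * η i ω

/-- The bidiagonal matrix with rows `(…, 1, -1, …)` that encodes the dynamics of one node over
the running steps `0, …, m`. -/
def nodeD (m : ℕ) : Matrix (Fin m) (Fin (m + 1)) ℝ :=
  fun s t => if t = s.castSucc then 1 else if t = s.succ then -1 else 0

variable (V) in
/-- The constraint matrix of all node state trajectories, one copy of `nodeD m` per node. -/
def stackedD [DecidableEq V] (m : ℕ) : Matrix (Fin m × V) (Fin (m + 1) × V) ℝ :=
  Matrix.blockDiagonal (fun _ : V => nodeD m)

/-- The control inputs `u_i(0), …, u_i(m - 1)` of all nodes as a function of a record `y` of the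
messages. -/
def inputs [Fintype V] {m : ℕ} (w : V → V → ℝ) (y : Fin (m + 1) × V → ℝ) : Fin m × V → ℝ :=
  fun p => ctrlInput w (fun j => y (p.1.castSucc, j)) p.2

/-- The mechanism `x ↦ x + γ` on the stacked state trajectories over the steps `0, …, m`. -/
def trajectoryMechanism [Fintype V] [DecidableEq V] {Ω : Type*} (m : ℕ) (γ : Ω → V → ℕ → ℝ) :
    (Fin (m + 1) × V → ℝ) → Ω → (Fin (m + 1) × V → ℝ) :=
  linearMechanism (1 : Matrix (Fin (m + 1) × V) (Fin (m + 1) × V) ℝ)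
    (fun ω p => γ ω p.2 p.1)

/-- All messages sent over the steps `0, …, m` when the algorithm is actually run in closed loop
from the initial states `x_i(0)` of the trajectory `x`. A state trajectory on the manifold with
`b = inputs w y` is determined by its initial states and the message record `y`. -/
def closedLoopMechanism [Fintype V] {Ω : Type*} (m : ℕ) (w : V → V → ℝ) (γ : Ω → V → ℕ → ℝ)
    (x : Fin (m + 1) × V → ℝ) (ω : Ω) : Fin (m + 1) × V → ℝ :=
  fun p => message w (γ ω) (fun i => x (0, i)) p.1 p.2

end Consensus

end

end AffineDP

namespace AffineDP

/-! The difference of two points of the manifold lies in the kernel of `stackedD`, so at each node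
it is constant in time. Nonsingularity of the selected columns leaves one node k where it can be
nonzero (`exists_eq_of_manifoldAdj`). The noise is also constant in time, so passing from x' to x
replaces σ_k η_k by σ_k η_k + c with |c| ≤ μ, and each mechanism is a fixed measurable map of the
noise vector. In closed loop this is because the messages obey an autonomous recursion that sees
initial state and noise only through their sum (`message_const_eq_iterate`).

Independence allows the other noises to be frozen (`measureReal_add_single_le`), leaving a scalar
shift. For Gaussian noise the worst events are half-lines, whose excess is κ, monotone in the shift
(`gaussianReal_shift_le`); for Laplace noise the density ratio is bounded pointwise
(`laplaceMeasure_shift_le`). -/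

theorem stackedD_mulVec {V : Type*} [Fintype V] [DecidableEq V] (m : ℕ)
    (v : Fin (m + 1) × V → ℝ) (s : Fin m) (i : V) :
    (stackedD V m).mulVec v (s, i) = v (s.castSucc, i) - v (s.succ, i) := by
  have h : s.castSucc ≠ s.succ := s.castSucc_lt_succ.ne
  have hn : ∀ t : Fin (m + 1), nodeD m s t * v (t, i) =
      (if t = s.castSucc then v (t, i) else 0) - (if t = s.succ then v (t, i) else 0) := by
    intro t
    unfold nodeD
    split_ifs with h1 h2 <;> simp_all
  simp only [Matrix.mulVec, dotProduct, stackedD, Matrix.blockDiagonal_apply, Fintype.sum_prod_type,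
    ite_mul, zero_mul]
  simp [hn, Finset.sum_sub_distrib]

/-- Kernel vectors of the constraint matrix are constant in time at each node. -/
theorem eq_init_of_stackedD_mulVec_eq_zero {V : Type*} [Fintype V] [DecidableEq V] {m : ℕ}
    {v : Fin (m + 1) × V → ℝ} (hv : (stackedD V m).mulVec v = 0) (t : Fin (m + 1)) (i : V) :
    v (t, i) = v (0, i) := by
  induction t using Fin.induction with
  | zero => rfl
  | succ s ih =>
    have := congrFun hv (s, i)
    rw [stackedD_mulVec] at this
    simp only [Pi.zero_apply] at this
    linarith

/-- Adjacent trajectories differ at a single node, by a constant of absolute value at most `μ`. -/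
theorem exists_eq_of_manifoldAdj {V : Type*} [Fintype V] [DecidableEq V] {m : ℕ} {μ : ℝ}
    {b : Fin m × V → ℝ} {x x' : Fin (m + 1) × V → ℝ}
    (hx : x ∈ affineManifold (stackedD V m) b) (hx' : x' ∈ affineManifold (stackedD V m) b)
    (h : ManifoldAdj (stackedD V m) μ x x') :
    ∃ (k : V) (c : ℝ), |c| ≤ μ ∧ ∀ p, x p = x' p + (Pi.single k c : V → ℝ) p.2 := by
  obtain ⟨d, hd, ⟨t₀, k⟩, -, hc, hk, -⟩ := h
  have hv : (stackedD V m).mulVec (x - x') = 0 := by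
    simp only [affineManifold, Set.mem_ofPred_eq] at hx hx'
    rw [Matrix.mulVec_sub, eq_neg_of_add_eq_zero_left hx, eq_neg_of_add_eq_zero_left hx', sub_self]
  have hconst := eq_init_of_stackedD_mulVec_eq_zero hv
  refine ⟨k, x (t₀, k) - x' (t₀, k), hc, ?_⟩
  rintro ⟨t, i⟩
  have h1 := hconst t i
  simp only [Pi.sub_apply] at h1
  by_cases hi : i = k
  · subst hi
    have h2 := hconst t₀ i
    simp only [Pi.sub_apply] at h2
    simp only [Pi.single_eq_same]
    linarith
  · simp only [Pi.single_apply, hi, if_false, add_zero]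
    by_contra hne
    -- If node i ≠ k differed, it would do so at all times, so all its coordinates would be selected
    -- by `d`. Its indicator is then a kernel vector supported on the selected columns, against
    -- nonsingularity.
    have hall : ∀ s, (s, i) ∈ Set.range d := by
      intro s
      by_contra hs
      have h3 := hk (s, i) hs (by simp [hi])
      have h4 := hconst s i
      simp only [Pi.sub_apply] at h4
      apply hne
      linarith
    let e : Fin (m + 1) × V → ℝ := fun p => if p.2 = i then 1 else 0
    have he : (stackedD V m).mulVec e = 0 := by
      ext ⟨s, j⟩
      rw [stackedD_mulVec]
      simp [e]
    have hed : ((stackedD V m).submatrix id d).mulVec (e ∘ d) = 0 := by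
      rw [← he]
      ext p
      simp only [Matrix.mulVec, dotProduct, Matrix.submatrix_apply, id, Function.comp]
      have := d.injective
      refine Finset.sum_of_injOn d this.injOn (by simp) ?_ (fun _ _ => rfl)
      rintro ⟨s, j⟩ - hj
      have : j ≠ i := by
        rintro rfl
        obtain ⟨a, ha⟩ := hall s
        exact hj ⟨a, by simp, ha⟩
      simp [e, this]
    have hz : e ∘ d = 0 := by
      have := (Matrix.isUnit_iff_isUnit_det _).2 hd
      exact (Matrix.mulVec_injective_of_isUnit this) (by rw [hed, Matrix.mulVec_zero])
    obtain ⟨a, ha⟩ := hall 0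
    have := congrFun hz a
    simp [ha, e] at this

/-! ### Closed-loop messages -/

/-- One step of the closed-loop recursion of the messages when the noise is constant in time. -/
def messageStep {V : Type*} [Fintype V] (w : V → V → ℝ) (y : V → ℝ) : V → ℝ :=
  fun i => y i + ctrlInput w y i

theorem message_const_eq_iterate {V : Type*} [Fintype V] (w : V → V → ℝ) (g x0 : V → ℝ) (t : ℕ) :
    message w (fun i _ => g i) x0 t = (messageStep w)^[t] (fun i => x0 i + g i) := by
  induction t with
  | zero => rfl
  | succ t ih =>
    rw [Function.iterate_succ_apply', ← ih]
    ext i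
    simp only [messageStep]
    change state w _ x0 t i + ctrlInput w (message w _ x0 t) i + g i =
      state w _ x0 t i + g i + _
    ring

theorem measurable_messageStep {V : Type*} [Fintype V] (w : V → V → ℝ) :
    Measurable (messageStep w) := by
  unfold messageStep ctrlInput
  fun_prop

/-! ### Reduction to one noise coordinate -/

/-- A one-dimensional privacy bound at node `k` extends to the vector of independent noises. -/
theorem measureReal_add_single_le {V Ω : Type*} [Fintype V] [DecidableEq V]
    [MeasurableSpace Ω] {P : Measure Ω} [IsProbabilityMeasure P]
    {η : V → Ω → ℝ} (hη : ∀ i, Measurable (η i)) (hindep : iIndepFun η P)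
    (σ : V → ℝ) (k : V) (c a δ : ℝ)
    (h : ∀ B : Set ℝ, MeasurableSet B →
      (P.map (η k)).real {z | σ k * z + c ∈ B} ≤ a * (P.map (η k)).real {z | σ k * z ∈ B} + δ)
    {S : Set (V → ℝ)} (hS : MeasurableSet S) :
    P.real {ω | (fun i => σ i * η i ω + (Pi.single k c : V → ℝ) i) ∈ S} ≤
      a * P.real {ω | (fun i => σ i * η i ω) ∈ S} + δ := by
  let T := ({k}ᶜ : Finset V)
  let Y : Ω → (T → ℝ) := fun ω i => η i ω
  have hY : Measurable Y := by fun_prop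
  -- The first component is the already scaled and shifted value at `k`; the others are raw noises.
  let comb : ℝ × (T → ℝ) → (V → ℝ) := fun q i =>
    if hi : i ∈ T then σ i * q.2 ⟨i, hi⟩ else q.1
  have hcomb : Measurable comb := by
    refine measurable_pi_lambda _ fun i => ?_
    by_cases hi : i ∈ T <;> simp only [comb, hi, dite_true, dite_false] <;> fun_prop
  have hind : IndepFun (η k) Y P := by
    have := (hindep.indepFun_finset {k} T (by simp [T]) hη)
    exact this.comp (φ := fun f : (({k} : Finset V) → ℝ) => f ⟨k, by simp⟩) (ψ := id)
      (by fun_prop) measurable_id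
  have hmap := (indepFun_iff_map_prod_eq_prod_map_map (hη k).aemeasurable hY.aemeasurable).1 hind
  have := Measure.isProbabilityMeasure_map (μ := P) (hη k).aemeasurable
  have := Measure.isProbabilityMeasure_map (μ := P) hY.aemeasurable
  have key : ∀ c : ℝ, P.real {ω | (fun i => σ i * η i ω + (Pi.single k c : V → ℝ) i) ∈ S} =
      ∫ y, (P.map (η k)).real {z | σ k * z + c ∈ {r | comb (r, y) ∈ S}} ∂(P.map Y) := by
    intro c
    have hm : MeasurableSet {q : ℝ × (T → ℝ) | comb (σ k * q.1 + c, q.2) ∈ S} :=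
      (hcomb.comp (by fun_prop : Measurable fun q : ℝ × (T → ℝ) => (σ k * q.1 + c, q.2))) hS
    have h1 : {ω | (fun i => σ i * η i ω + (Pi.single k c : V → ℝ) i) ∈ S} =
        (fun ω => (η k ω, Y ω)) ⁻¹' {q : ℝ × (T → ℝ) | comb (σ k * q.1 + c, q.2) ∈ S} := by
      ext ω
      simp only [Set.mem_ofPred_eq, Set.mem_preimage]
      have : (fun i => σ i * η i ω + (Pi.single k c : V → ℝ) i) = comb (σ k * η k ω + c, Y ω) := by
        ext i
        by_cases hi : i = k
        · subst hi; simp [comb, T]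
        · simp [comb, T, hi, Y]
      rw [this]
    rw [h1, ← map_measureReal_apply ((hη k).prodMk hY) hm, hmap]
    rw [measureReal_def, Measure.prod_apply_symm hm, ← integral_toReal]
    · rfl
    · exact (measurable_measure_prodMk_right hm).aemeasurable
    · exact Filter.Eventually.of_forall fun y => measure_lt_top _ _
  have hint : ∀ c : ℝ, Integrable (fun y => (P.map (η k)).real
      {z | σ k * z + c ∈ {r | comb (r, y) ∈ S}}) (P.map Y) := by
    intro c
    have hm : MeasurableSet {q : ℝ × (T → ℝ) | comb (σ k * q.1 + c, q.2) ∈ S} :=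
      (hcomb.comp (by fun_prop : Measurable fun q : ℝ × (T → ℝ) => (σ k * q.1 + c, q.2))) hS
    refine Integrable.of_bound (C := 1)
      (measurable_measure_prodMk_right (μ := P.map (η k)) hm).ennreal_toReal.aestronglyMeasurable ?_
    refine Filter.Eventually.of_forall fun y => ?_
    rw [Real.norm_of_nonneg measureReal_nonneg]
    exact measureReal_le_one
  have h0 : P.real {ω | (fun i => σ i * η i ω) ∈ S} =
      ∫ y, (P.map (η k)).real {z | σ k * z + 0 ∈ {r | comb (r, y) ∈ S}} ∂(P.map Y) := by
    rw [← key 0]; simp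
  rw [key c, h0]
  calc _ ≤ ∫ y, (a * (P.map (η k)).real {z | σ k * z + 0 ∈ {r | comb (r, y) ∈ S}} + δ)
        ∂(P.map Y) := by
        refine integral_mono (hint c) (((hint 0).const_mul a).add (integrable_const _)) fun y => ?_
        simpa using h {r | comb (r, y) ∈ S} ((hcomb.comp (by fun_prop)) hS)
    _ = _ := by
        rw [integral_add ((hint 0).const_mul a) (integrable_const _), integral_const_mul]
        simp

/-! ### Gaussian noise and the calibration function -/

/-- If `μ` dominates `a • ν` on `H` and is dominated by it off `H`, then `H` maximizes
`μ - a • ν`. -/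
theorem measureReal_le_of_threshold {α : Type*} [MeasurableSpace α] {μ ν : Measure α}
    [IsFiniteMeasure μ] [IsFiniteMeasure ν] {a : ℝ} {H : Set α} (hH : MeasurableSet H)
    (hle : ∀ A, MeasurableSet A → A ⊆ H → a * ν.real A ≤ μ.real A)
    (hge : ∀ A, MeasurableSet A → A ⊆ Hᶜ → μ.real A ≤ a * ν.real A)
    {B : Set α} (hB : MeasurableSet B) :
    μ.real B ≤ a * ν.real B + (μ.real H - a * ν.real H) := by
  have h1 := hle (H \ B) (hH.diff hB) Set.sdiff_subset
  have h2 := hge (B \ H) (hB.diff hH) (fun x hx => hx.2)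
  have e1 := measureReal_inter_add_sdiff (μ := μ) (s := B) hH
  have e2 := measureReal_inter_add_sdiff (μ := ν) (s := B) hH
  have e3 := measureReal_inter_add_sdiff (μ := μ) (s := H) hB
  have e4 := measureReal_inter_add_sdiff (μ := ν) (s := H) hB
  rw [Set.inter_comm] at e3 e4
  rw [← e1, ← e2, ← e3, ← e4]
  linarith

theorem gaussianReal_real_eq_integral (m : ℝ) (A : Set ℝ) :
    (gaussianReal m 1).real A = ∫ v in A, gaussianPDFReal m 1 v := by
  rw [measureReal_def, gaussianReal_apply_eq_integral m one_ne_zero,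
    ENNReal.toReal_ofReal (integral_nonneg fun v => gaussianPDFReal_nonneg m 1 v)]

theorem Phi_eq_integral (v : ℝ) : Phi v = ∫ z in Set.Iic v, gaussianPDFReal 0 1 z := by
  rw [Phi, cdf_eq_real, gaussianReal_real_eq_integral]

theorem continuous_gaussianPDFReal (m : ℝ) : Continuous (gaussianPDFReal m 1) := by
  unfold gaussianPDFReal
  fun_prop

theorem hasDerivAt_Phi (v : ℝ) : HasDerivAt Phi (gaussianPDFReal 0 1 v) v := by
  have hi := integrable_gaussianPDFReal 0 1
  have h : Phi = fun u => (∫ z in (0 : ℝ)..u, gaussianPDFReal 0 1 z) + Phi 0 := by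
    ext u
    rw [Phi_eq_integral, Phi_eq_integral,
      ← intervalIntegral.integral_Iic_sub_Iic hi.integrableOn hi.integrableOn]
    ring
  rw [h]
  exact (intervalIntegral.integral_hasDerivAt_right hi.intervalIntegrable
    ((continuous_gaussianPDFReal 0).stronglyMeasurableAtFilter _ _)
    (continuous_gaussianPDFReal 0).continuousAt).add_const _

/-- This identity cancels the x / y² terms in the derivative of `kappa x`, leaving a Gaussian
density, hence monotonicity. -/
theorem exp_mul_gaussianPDFReal {x y : ℝ} (hy : y ≠ 0) :
    Real.exp x * gaussianPDFReal 0 1 (-(y / 2) - x / y) = gaussianPDFReal 0 1 (y / 2 - x / y) := by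
  simp only [gaussianPDFReal, NNReal.coe_one]
  rw [mul_left_comm, ← Real.exp_add]
  congr 2
  field_simp
  ring

theorem hasDerivAt_kappa (x : ℝ) {y : ℝ} (hy : y ≠ 0) :
    HasDerivAt (kappa x) (gaussianPDFReal 0 1 (y / 2 - x / y)) y := by
  have hdiv : HasDerivAt (fun y : ℝ => x / y) (-x / y ^ 2) y := by
    refine ((hasDerivAt_const y x).div (hasDerivAt_id y) hy).congr_deriv ?_
    simp
  have hhalf : HasDerivAt (fun y : ℝ => y / 2) (1 / 2) y := (hasDerivAt_id y).div_const 2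
  have h1 := (hasDerivAt_Phi _).comp y (hhalf.sub hdiv)
  have h2 := ((hasDerivAt_Phi _).comp y (hhalf.neg.sub hdiv)).const_mul (Real.exp x)
  refine (h1.sub h2).congr_deriv ?_
  simp only [Pi.sub_apply, Pi.neg_apply]
  rw [← mul_assoc, exp_mul_gaussianPDFReal hy]
  ring

theorem continuousOn_kappa (x : ℝ) : ContinuousOn (kappa x) (Set.Ioi 0) :=
  fun _ hy => (hasDerivAt_kappa x (ne_of_gt hy)).continuousAt.continuousWithinAt

theorem monotoneOn_kappa (x : ℝ) : MonotoneOn (kappa x) (Set.Ioi 0) := by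
  refine monotoneOn_of_deriv_nonneg (convex_Ioi 0) (continuousOn_kappa x) ?_ ?_
  · rw [interior_Ioi]
    exact fun y hy => (hasDerivAt_kappa x (ne_of_gt hy)).differentiableAt.differentiableWithinAt
  · rw [interior_Ioi]
    intro y hy
    rw [(hasDerivAt_kappa x (ne_of_gt hy)).deriv]
    exact gaussianPDFReal_nonneg _ _ _

open Filter Topology in
theorem tendsto_kappa_zero {x : ℝ} (hx : 0 < x) : Tendsto (kappa x) (𝓝[>] 0) (𝓝 0) := by
  have hdiv : Tendsto (fun y : ℝ => -(x / y)) (𝓝[>] 0) atBot := by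
    simp only [div_eq_mul_inv]
    exact tendsto_neg_atTop_atBot.comp (tendsto_inv_nhdsGT_zero.const_mul_atTop hx)
  have hh : Tendsto (fun y : ℝ => y / 2) (𝓝[>] 0) (𝓝 0) :=
    (Continuous.tendsto' (by fun_prop) 0 0 (by simp)).mono_left nhdsWithin_le_nhds
  have hP : Tendsto Phi atBot (𝓝 0) := tendsto_cdf_atBot _
  have h1 := hP.comp (hh.add_atBot hdiv)
  have h2 := (hP.comp (hh.neg.add_atBot hdiv)).const_mul (Real.exp x)
  have h3 := h1.sub h2
  simp only [mul_zero, sub_zero] at h3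
  exact h3

open Filter Topology in
theorem tendsto_kappa_atTop (x : ℝ) : Tendsto (kappa x) atTop (𝓝 1) := by
  have hdiv : Tendsto (fun y : ℝ => -(x / y)) atTop (𝓝 (-0)) :=
    (tendsto_const_nhds.div_atTop tendsto_id).neg
  have hh : Tendsto (fun y : ℝ => y / 2) atTop atTop := tendsto_id.atTop_div_const two_pos
  have h1 := (tendsto_cdf_atTop (gaussianReal 0 1)).comp (hh.atTop_add hdiv)
  have h2 := ((tendsto_cdf_atBot (gaussianReal 0 1)).comp
    ((tendsto_neg_atTop_atBot.comp hh).atBot_add hdiv)).const_mul (Real.exp x)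
  have h3 := h1.sub h2
  simp only [mul_zero, sub_zero] at h3
  exact h3

/-- `Function.invFunOn` is meaningful only on the image, which contains (0, 1) by the limits 0 and 1
and the intermediate value theorem. -/
theorem kappaInv_spec {x d : ℝ} (hx : 0 < x) (hd : 0 < d) (hd1 : d < 1) :
    0 < kappaInv x d ∧ kappa x (kappaInv x d) = d := by
  have h : d ∈ kappa x '' Set.Ioi 0 :=
    isPreconnected_Ioi.intermediate_value_Ioo (l₁ := nhdsWithin 0 (Set.Ioi 0)) (l₂ := Filter.atTop)
      inf_le_right (Filter.le_principal_iff.2 (Filter.Ioi_mem_atTop 0)) (continuousOn_kappa x)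
      (tendsto_kappa_zero hx) (tendsto_kappa_atTop x) ⟨hd, hd1⟩
  exact ⟨Function.invFunOn_mem h, Function.invFunOn_eq h⟩

theorem gaussianPDFReal_ratio (s v : ℝ) :
    gaussianPDFReal s 1 v = Real.exp (s * v - s ^ 2 / 2) * gaussianPDFReal 0 1 v := by
  simp only [gaussianPDFReal, NNReal.coe_one]
  rw [mul_left_comm, ← Real.exp_add]
  congr 2
  ring

theorem gaussianReal_real_Ici (m v : ℝ) : (gaussianReal m 1).real (Set.Ici v) = Phi (m - v) := by
  have h : (gaussianReal 0 1).map (fun z => m - z) = gaussianReal m 1 := by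
    simp [gaussianReal_map_const_sub]
  rw [Phi, cdf_eq_real, ← h, map_measureReal_apply (by fun_prop) measurableSet_Ici]
  congr 1
  ext z
  simp only [Set.mem_preimage, Set.mem_Ici, Set.mem_Iic]
  constructor <;> intro h <;> linarith

/-- Neyman–Pearson: the likelihood ratio exp (s v - s² / 2) is at least exp ε exactly when v ≥ s / 2
+ ε / s, and that half-line attains the excess `kappa ε s`. -/
theorem gaussianReal_real_le_add_kappa {s : ℝ} (hs : 0 < s) (ε : ℝ) {B : Set ℝ}
    (hB : MeasurableSet B) :
    (gaussianReal s 1).real B ≤ Real.exp ε * (gaussianReal 0 1).real B + kappa ε s := by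
  have hi : ∀ (m : ℝ) (A : Set ℝ), IntegrableOn (gaussianPDFReal m 1) A volume :=
    fun m A => (integrable_gaussianPDFReal m 1).integrableOn
  have hH : ∀ v, ε ≤ s * v - s ^ 2 / 2 ↔ s / 2 + ε / s ≤ v := by
    intro v
    rw [← mul_le_mul_iff_right₀ hs (b := s / 2 + ε / s)]
    have : s * (s / 2 + ε / s) = s ^ 2 / 2 + ε := by field_simp
    rw [this]
    constructor <;> intro h <;> linarith
  have key := measureReal_le_of_threshold (μ := gaussianReal s 1) (ν := gaussianReal 0 1)
    (a := Real.exp ε) (H := Set.Ici (s / 2 + ε / s)) measurableSet_Ici ?_ ?_ hB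
  · rw [gaussianReal_real_Ici, gaussianReal_real_Ici] at key
    rwa [show s - (s / 2 + ε / s) = s / 2 - ε / s by ring,
      show 0 - (s / 2 + ε / s) = -(s / 2) - ε / s by ring] at key
  · intro A hA hAH
    rw [gaussianReal_real_eq_integral, gaussianReal_real_eq_integral, ← integral_const_mul]
    refine setIntegral_mono_on ((hi 0 A).const_mul _) (hi s A) hA fun v hv => ?_
    rw [gaussianPDFReal_ratio s]
    gcongr
    · exact gaussianPDFReal_nonneg _ _ _
    · exact (hH v).2 (hAH hv)
  · intro A hA hAH
    rw [gaussianReal_real_eq_integral, gaussianReal_real_eq_integral, ← integral_const_mul]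
    refine setIntegral_mono_on (hi s A) ((hi 0 A).const_mul _) hA fun v hv => ?_
    rw [gaussianPDFReal_ratio s]
    gcongr
    · exact gaussianPDFReal_nonneg _ _ _
    · exact (not_le.1 fun h => hAH hv ((hH v).1 h)).le

theorem gaussianReal_shift_le {ε δ s : ℝ} (hε : 0 < ε) (hδ : 0 < δ) (hδ1 : δ < 1)
    (hs : |s| ≤ kappaInv ε δ) {B : Set ℝ} (hB : MeasurableSet B) :
    (gaussianReal 0 1).real {z | z + s ∈ B} ≤ Real.exp ε * (gaussianReal 0 1).real B + δ := by
  obtain ⟨hpos, hval⟩ := kappaInv_spec hε hδ hδ1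
  have hmono : ∀ r, 0 < r → r ≤ kappaInv ε δ → kappa ε r ≤ δ := fun r hr hle =>
    (monotoneOn_kappa ε hr hpos hle).trans hval.le
  have hshift : (gaussianReal 0 1).real {z | z + s ∈ B} = (gaussianReal s 1).real B := by
    have h : (gaussianReal 0 1).map (fun z => z + s) = gaussianReal s 1 := by
      simp [gaussianReal_map_add_const]
    rw [← h, map_measureReal_apply (by fun_prop) hB]
    rfl
  rw [hshift]
  -- The `kappa` bound needs a positive shift: negative shifts are reflected, and zero is trivial.
  rcases lt_trichotomy s 0 with h | rfl | h
  · have hneg : ∀ m, (gaussianReal m 1).real B = (gaussianReal (-m) 1).real {z | -z ∈ B} := by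
      intro m
      have h' : (gaussianReal (-m) 1).map (fun z => -z) = gaussianReal m 1 := by
        simp [gaussianReal_map_neg]
      rw [← h', map_measureReal_apply (by fun_prop) hB]
      rfl
    rw [hneg s, hneg 0, neg_zero]
    have := gaussianReal_real_le_add_kappa (neg_pos.2 h) ε (measurable_neg hB)
    have h2 := hmono (-s) (neg_pos.2 h) (by rwa [← abs_of_neg h])
    exact this.trans (add_le_add_right h2 _)
  · have := Real.one_le_exp hε.le
    nlinarith [measureReal_nonneg (μ := gaussianReal 0 1) (s := B)]
  · have := gaussianReal_real_le_add_kappa h ε hB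
    have h2 := hmono s h (by rwa [← abs_of_pos h])
    linarith

/-! ### Laplace noise and the scaled mechanisms -/

theorem laplaceMeasure_shift_le {s ε : ℝ} (hs : |s| ≤ ε) {B : Set ℝ} (hB : MeasurableSet B) :
    laplaceMeasure 0 1 {z | z + s ∈ B} ≤ ENNReal.ofReal (Real.exp ε) * laplaceMeasure 0 1 B := by
  have hBs : MeasurableSet {z : ℝ | z + s ∈ B} := (measurable_add_const s) hB
  unfold laplaceMeasure
  set f : ℝ → ENNReal := fun v => ENNReal.ofReal ((2 * 1)⁻¹ * Real.exp (-|v - 0| / 1)) with hf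
  have hfm : Measurable f := by fun_prop
  have hle : ∀ v, f v ≤ ENNReal.ofReal (Real.exp ε) * f (v + s) := by
    intro v
    rw [hf, ← ENNReal.ofReal_mul (Real.exp_pos _).le]
    refine ENNReal.ofReal_le_ofReal ?_
    rw [mul_left_comm, ← Real.exp_add]
    have : |v + s| ≤ |v| + |s| := abs_add_le v s
    gcongr
    simp only [sub_zero, div_one]
    linarith
  rw [withDensity_apply _ hBs, withDensity_apply _ hB]
  calc ∫⁻ v in {z | z + s ∈ B}, f v
      ≤ ∫⁻ v in {z | z + s ∈ B}, ENNReal.ofReal (Real.exp ε) * f (v + s) := lintegral_mono hle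
    _ = ENNReal.ofReal (Real.exp ε) * ∫⁻ v in (fun z => z + s) ⁻¹' B, f (v + s) :=
        lintegral_const_mul _ (by fun_prop)
    _ = ENNReal.ofReal (Real.exp ε) * ∫⁻ v in B, f v := by
        rw [(measurePreserving_add_right volume s).setLIntegral_comp_preimage hB hfm]

theorem measureReal_mul_add_le_of_shift {ν : Measure ℝ} {r a δ : ℝ} (hr : r ≠ 0) (c : ℝ)
    (h : ∀ B, MeasurableSet B → ν.real {z | z + c / r ∈ B} ≤ a * ν.real B + δ)
    {B : Set ℝ} (hB : MeasurableSet B) :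
    ν.real {z | r * z + c ∈ B} ≤ a * ν.real {z | r * z ∈ B} + δ := by
  have := h {z | r * z ∈ B} ((measurable_const_mul r) hB)
  have e : {z : ℝ | z + c / r ∈ {z | r * z ∈ B}} = {z | r * z + c ∈ B} := by
    ext z
    simp only [Set.mem_ofPred_eq]
    rw [mul_add, mul_div_cancel₀ _ hr]
  rwa [e] at this

theorem gaussian_mechanism_le {ε δ μ r c : ℝ} (hε : 0 < ε) (hμ : 0 < μ) (hδ : 0 < δ) (hδ1 : δ < 1)
    (hr : r ^ 2 ≥ μ ^ 2 / (kappaInv ε δ) ^ 2) (hc : |c| ≤ μ) {B : Set ℝ} (hB : MeasurableSet B) :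
    (gaussianReal 0 1).real {z | r * z + c ∈ B} ≤
      Real.exp ε * (gaussianReal 0 1).real {z | r * z ∈ B} + δ := by
  obtain ⟨hpos, -⟩ := kappaInv_spec hε hδ hδ1
  rw [← div_pow] at hr
  -- Only r² is controlled, so r may be negative.
  have habs : μ / kappaInv ε δ ≤ |r| := by
    simpa [abs_of_pos (div_pos hμ hpos)] using sq_le_sq.1 hr
  have hr0 : 0 < |r| := (div_pos hμ hpos).trans_le habs
  refine measureReal_mul_add_le_of_shift (abs_pos.1 hr0) c
    (fun B hB => gaussianReal_shift_le hε hδ hδ1 ?_ hB) hB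
  rw [abs_div, div_le_iff₀ hr0]
  rw [div_le_iff₀ hpos] at habs
  linarith

theorem laplace_mechanism_le [IsFiniteMeasure (laplaceMeasure 0 1)] {ε μ r c : ℝ}
    (hε : 0 < ε) (hμ : 0 < μ) (hr : r ≥ μ / ε) (hc : |c| ≤ μ) {B : Set ℝ} (hB : MeasurableSet B) :
    (laplaceMeasure 0 1).real {z | r * z + c ∈ B} ≤
      Real.exp ε * (laplaceMeasure 0 1).real {z | r * z ∈ B} + 0 := by
  have hr0 : 0 < r := (div_pos hμ hε).trans_le hr
  refine measureReal_mul_add_le_of_shift hr0.ne' c (fun B hB => ?_) hB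
  have hs : |c / r| ≤ ε := by
    rw [abs_div, abs_of_pos hr0, div_le_iff₀ hr0]
    rw [ge_iff_le, div_le_iff₀ hε] at hr
    linarith
  have := ENNReal.toReal_mono (ENNReal.mul_ne_top ENNReal.ofReal_ne_top (measure_ne_top _ _))
    (laplaceMeasure_shift_le hs hB)
  rwa [ENNReal.toReal_mul, ENNReal.toReal_ofReal (Real.exp_pos ε).le, ← add_zero (_ * _)] at this

end AffineDP

/-! ### Assembly -/

open AffineDP in
theorem theorem4 {V Ω : Type*} [Fintype V] [DecidableEq V]
    (G : SimpleGraph V) (hG : G.Connected) (w : V → V → ℝ) (hw : IsConsensusWeight G w)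
    [MeasurableSpace Ω] (P : Measure Ω) [IsProbabilityMeasure P]
    (η : V → Ω → ℝ) (hη : ∀ i, Measurable (η i)) (hindep : iIndepFun η P)
    (σ : V → ℝ) (ε δ μ : ℝ) (hε : 0 < ε) (hμ : 0 < μ)
    (hcase :
      ((0 < δ ∧ δ < 1) ∧ (∀ i, P.map (η i) = gaussianReal 0 1) ∧
          ∀ i, σ i ^ 2 ≥ μ ^ 2 / (kappaInv ε δ) ^ 2) ∨
      (δ = 0 ∧ (∀ i, P.map (η i) = laplaceMeasure 0 1) ∧ ∀ i, σ i ≥ μ / ε))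
    (m : ℕ) :
    (∀ b : Fin m × V → ℝ,
      DiffPrivateOver P (trajectoryMechanism m (constNoise σ η)) (stackedD V m) b μ ε δ) ∧
    (∀ y : Fin (m + 1) × V → ℝ,
      DiffPrivateOver P (closedLoopMechanism m w (constNoise σ η))
        (stackedD V m) (inputs w y) μ ε δ) := by
  have hnode : ∀ (k : V) (c : ℝ), |c| ≤ μ → ∀ B : Set ℝ, MeasurableSet B →
      (P.map (η k)).real {z | σ k * z + c ∈ B} ≤
        Real.exp ε * (P.map (η k)).real {z | σ k * z ∈ B} + δ := by
    intro k c hc B hB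
    rcases hcase with ⟨⟨hδ, hδ1⟩, hlaw, hσ⟩ | ⟨rfl, hlaw, hσ⟩
    · rw [hlaw k]
      exact gaussian_mechanism_le hε hμ hδ hδ1 (hσ k) hc hB
    · have : IsFiniteMeasure (laplaceMeasure 0 1) := by
        rw [← hlaw k]
        infer_instance
      rw [hlaw k]
      exact laplace_mechanism_le hε hμ (hσ k) hc hB
  have hshift : ∀ (k : V) (c : ℝ), |c| ≤ μ → ∀ {S : Set (V → ℝ)}, MeasurableSet S →
      P.real {ω | (fun i => σ i * η i ω + (Pi.single k c : V → ℝ) i) ∈ S} ≤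
        Real.exp ε * P.real {ω | (fun i => σ i * η i ω) ∈ S} + δ := fun k c hc _ hS =>
    measureReal_add_single_le hη hindep σ k c _ δ (hnode k c hc) hS
  constructor
  · intro b x hx x' hx' hadj R hR
    obtain ⟨k, c, hc, hxx⟩ := exists_eq_of_manifoldAdj hx hx' hadj
    let E : (V → ℝ) → (Fin (m + 1) × V → ℝ) := fun g p => x' p + g p.2
    have hE : Measurable E := by fun_prop
    have h' : ∀ ω, trajectoryMechanism m (constNoise σ η) x' ω = E (fun i => σ i * η i ω) := by
      intro ω
      ext p
      simp [trajectoryMechanism, linearMechanism, constNoise, E]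
    have h : ∀ ω, trajectoryMechanism m (constNoise σ η) x ω =
        E (fun i => σ i * η i ω + (Pi.single k c : V → ℝ) i) := by
      intro ω
      ext p
      simp only [trajectoryMechanism, linearMechanism, constNoise, E, Matrix.one_mulVec,
        Pi.add_apply, hxx p]
      ring
    simp only [h, h']
    exact hshift k c hc (hE hR)
  · intro y x hx x' hx' hadj R hR
    obtain ⟨k, c, hc, hxx⟩ := exists_eq_of_manifoldAdj hx hx' hadj
    -- The whole closed-loop record is post-processing of the noise vector, so feedback costs no
    -- privacy.
    let E : (V → ℝ) → (Fin (m + 1) × V → ℝ) := fun g p =>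
      (messageStep w)^[p.1] (fun i => x' (0, i) + g i) p.2
    have hE : Measurable E := by
      refine measurable_pi_lambda _ fun p => ?_
      exact (measurable_pi_apply p.2).comp
        (((measurable_messageStep w).iterate p.1).comp (by fun_prop))
    have hgen : ∀ z ω, closedLoopMechanism m w (constNoise σ η) z ω = fun p =>
        (messageStep w)^[p.1] (fun i => z (0, i) + σ i * η i ω) p.2 := by
      intro z ω
      ext p
      rw [← message_const_eq_iterate]
      rfl
    have h' : ∀ ω, closedLoopMechanism m w (constNoise σ η) x' ω = E (fun i => σ i * η i ω) :=
      hgen x'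
    have h : ∀ ω, closedLoopMechanism m w (constNoise σ η) x ω =
        E (fun i => σ i * η i ω + (Pi.single k c : V → ℝ) i) := by
      intro ω
      rw [hgen]
      simp only [E, hxx, add_assoc, add_comm (σ _ * η _ ω)]
    simp only [h, h']
    exact hshift k c hc (hE hR)
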